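/- Let $\mathbb{O}$ be the real algebra of octonions with unit $1$, with its Euclidean norm $\|\cdot\|$ and standard involution $\alpha 1+u\mapsto(\alpha 1+u)^*:=\alpha 1-u$ ($\alpha\in\mathbb{R}$, $u$ purely imaginary). For a linear isometry $f$ of $\mathbb{O}$ with $f(1)=1$, let $\mathbb{O}^f$ be the space $\mathbb{O}$ with the product $x\bullet y=f(x)f(y)$; the map $*$ is an involution of $\mathbb{O}^f$. Let $(\mathbb{O}^f)_*$ be the cracovian algebra generated by $\mathbb{O}^f$, that is, the space $\mathbb{O}$ with the product $x\odot y=x^*\bullet y$. Write $(x,y,z)=(xy)z-x(yz)$ and $x^2=xx$ in any algebra. A finite-dimensional algebra has degree $n$ if $n$ is the least natural number such that all its subalgebras generated by one element have dimension $\le n$. Proposition 4.6. There is a linear isometry $f$ of $\mathbb{O}$ with $f(1)=1$ such that $\mathbb{O}^f$ contains no $4$-dimensional subalgebra. For every such $f$, the algebra $B=(\mathbb{O}^f)_*$ has the following properties. 1. $B$ contains a $2$-dimensional subalgebra but no $4$-dimensional subalgebra, and $B$ has degree $8$. 2. $B$ satisfies the identity $(x^2,y,x^2)=0$ for all $x,y\in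 B$, but it does not satisfy the identity $(x,x^2,x)=0$: there is $x\in B$ with $(x,x^2,x)\neq 0$. -/

import Mathlib

open scoped Quaternion InnerProductSpace

noncomputable section

/-- The octonions, as a Euclidean space: the Cayley-Dickson double `ℍ × ℍ` of the quaternions, with
norm `‖(a, b)‖² = ‖a‖² + ‖b‖²`. -/
def Octonion : Type := WithLp 2 (ℍ[ℝ] × ℍ[ℝ])

namespace Octonion

instance : NormedAddCommGroup Octonion := inferInstanceAs (NormedAddCommGroup (WithLp 2 (ℍ[ℝ] × ℍ[ℝ])))
instance : InnerProductSpace ℝ Octonion :=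
  inferInstanceAs (InnerProductSpace ℝ (WithLp 2 (ℍ[ℝ] × ℍ[ℝ])))
instance : FiniteDimensional ℝ Octonion :=
  inferInstanceAs (FiniteDimensional ℝ (WithLp 2 (ℍ[ℝ] × ℍ[ℝ])))

/-- The octonion `(a, b)`. -/
def mk (a b : ℍ[ℝ]) : Octonion := WithLp.toLp 2 (a, b)

/-- The first quaternion component of an octonion. -/
def fst (x : Octonion) : ℍ[ℝ] := WithLp.fst x

/-- The second quaternion component of an octonion. -/
def snd (x : Octonion) : ℍ[ℝ] := WithLp.snd x

@[simp] theorem fst_mk (a b : ℍ[ℝ]) : (mk a b).fst = a := rfl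
@[simp] theorem snd_mk (a b : ℍ[ℝ]) : (mk a b).snd = b := rfl

@[ext] theorem ext {x y : Octonion} (h₁ : x.fst = y.fst) (h₂ : x.snd = y.snd) : x = y :=
  (WithLp.ofLp_injective 2) (Prod.ext h₁ h₂)

@[simp] theorem fst_add (x y : Octonion) : (x + y).fst = x.fst + y.fst := rfl
@[simp] theorem snd_add (x y : Octonion) : (x + y).snd = x.snd + y.snd := rfl
@[simp] theorem fst_sub (x y : Octonion) : (x - y).fst = x.fst - y.fst := rfl
@[simp] theorem snd_sub (x y : Octonion) : (x - y).snd = x.snd - y.snd := rfl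
@[simp] theorem fst_zero : (0 : Octonion).fst = 0 := rfl
@[simp] theorem snd_zero : (0 : Octonion).snd = 0 := rfl
@[simp] theorem fst_smul (r : ℝ) (x : Octonion) : (r • x).fst = r • x.fst := rfl
@[simp] theorem snd_smul (r : ℝ) (x : Octonion) : (r • x).snd = r • x.snd := rfl

/-- The unit octonion. -/
instance : One Octonion := ⟨mk 1 0⟩

@[simp] theorem fst_one : (1 : Octonion).fst = 1 := rfl
@[simp] theorem snd_one : (1 : Octonion).snd = 0 := rfl

/-- The Cayley-Dickson product `(a, b) (c, d) = (a c - d̄ b, d a + b c̄)`. -/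
instance : Mul Octonion :=
  ⟨fun x y => mk (x.fst * y.fst - star y.snd * x.snd) (y.snd * x.fst + x.snd * star y.fst)⟩

@[simp] theorem fst_mul (x y : Octonion) :
    (x * y).fst = x.fst * y.fst - star y.snd * x.snd := rfl
@[simp] theorem snd_mul (x y : Octonion) :
    (x * y).snd = y.snd * x.fst + x.snd * star y.fst := rfl

instance : NonUnitalNonAssocRing Octonion where
  __ := (inferInstance : AddCommGroup Octonion)
  left_distrib x y z := by ext1 <;> simp [mul_add, add_mul] <;> abel
  right_distrib x y z := by ext1 <;> simp [mul_add, add_mul] <;> abel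
  zero_mul x := by ext1 <;> simp
  mul_zero x := by ext1 <;> simp

instance : IsScalarTower ℝ Octonion Octonion where
  smul_assoc r x y := by
    change (r • x) * y = r • (x * y)
    ext1 <;> simp [smul_sub, smul_add]

instance : SMulCommClass ℝ Octonion Octonion where
  smul_comm r x y := by
    change r • (x * y) = x * (r • y)
    ext1 <;> simp [smul_sub, smul_add]

/-- The standard involution `(a, b) ↦ (ā, -b)`, i.e. `α • 1 + u ↦ α • 1 - u` for real `α` and
purely imaginary `u`. -/
instance : StarRing Octonion where
  star x := mk (star x.fst) (-x.snd)
  star_involutive x := by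
    apply ext
    · exact star_star x.fst
    · exact neg_neg x.snd
  star_mul x y := by
    apply ext
    · change star (x.fst * y.fst - star y.snd * x.snd) =
        star y.fst * star x.fst - star (-x.snd) * (-y.snd)
      simp
    · change -(y.snd * x.fst + x.snd * star y.fst) =
        (-x.snd) * star y.fst + (-y.snd) * star (star x.fst)
      rw [star_star]; noncomm_ring
  star_add x y := by
    apply ext
    · exact star_add x.fst y.fst
    · exact neg_add x.snd y.snd

@[simp] theorem fst_star (x : Octonion) : (star x).fst = star x.fst := rfl
@[simp] theorem snd_star (x : Octonion) : (star x).snd = -x.snd := rfl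

instance : StarModule ℝ Octonion where
  star_smul r x := by ext1 <;> simp

/-- The standard involution is `x ↦ 2 (1 | x) 1 - x`. -/
theorem star_eq (x : Octonion) : star x = (2 * ⟪(1 : Octonion), x⟫_ℝ) • (1 : Octonion) - x := by
  have h : ⟪(1 : Octonion), x⟫_ℝ = x.fst.re := by
    have h0 := WithLp.prod_inner_apply (𝕜 := ℝ) (E := ℍ[ℝ]) (F := ℍ[ℝ])
      (WithLp.toLp 2 (1, 0)) x
    refine Eq.trans h0 ?_
    simp [Quaternion.inner_def]
    rfl
  rw [h]
  apply ext
  · rw [fst_star, fst_sub, fst_smul, fst_one]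
    ext <;> simp; ring
  · simp

end Octonion

/-- The linear isometries of the Euclidean space of octonions that fix `1`. -/
abbrev OctonionIsometry : Type := {f : Octonion →ₗᵢ[ℝ] Octonion // f 1 = 1}

theorem OctonionIsometry.map_star (f : OctonionIsometry) (x : Octonion) :
    f.1 (star x) = star (f.1 x) := by
  have h : ⟪(1 : Octonion), f.1 x⟫_ℝ = ⟪(1 : Octonion), x⟫_ℝ := by
    have h1 := f.1.inner_map_map 1 x
    rwa [f.2] at h1
  rw [Octonion.star_eq, Octonion.star_eq, map_sub, map_smul, f.2, h]

/-- The algebra `𝕆^f`: the space of octonions with the product `x • y = f(x) f(y)`. -/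
def OctonionIsotope (_f : OctonionIsometry) : Type := Octonion

namespace OctonionIsotope

variable (f : OctonionIsometry)

instance : AddCommGroup (OctonionIsotope f) := inferInstanceAs (AddCommGroup Octonion)
instance : Module ℝ (OctonionIsotope f) := inferInstanceAs (Module ℝ Octonion)
instance : FiniteDimensional ℝ (OctonionIsotope f) :=
  inferInstanceAs (FiniteDimensional ℝ Octonion)

instance : Mul (OctonionIsotope f) := ⟨fun x y => (f.1 x * f.1 y : Octonion)⟩

instance : NonUnitalNonAssocRing (OctonionIsotope f) where
  __ := (inferInstance : AddCommGroup (OctonionIsotope f))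
  left_distrib x y z :=
    (congrArg (fun t : Octonion => f.1 x * t) (map_add f.1 y z)).trans (mul_add (f.1 x) _ _)
  right_distrib x y z :=
    (congrArg (fun t : Octonion => t * f.1 z) (map_add f.1 x y)).trans (add_mul _ _ (f.1 z))
  zero_mul x := (congrArg (fun t : Octonion => t * f.1 x) (map_zero f.1)).trans (zero_mul _)
  mul_zero x := (congrArg (fun t : Octonion => f.1 x * t) (map_zero f.1)).trans (mul_zero _)

instance : IsScalarTower ℝ (OctonionIsotope f) (OctonionIsotope f) where
  smul_assoc r x y :=
    (congrArg (fun t : Octonion => t * f.1 y) (map_smul f.1 r x)).trans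
      (smul_mul_assoc r (f.1 x) (f.1 y))

instance : SMulCommClass ℝ (OctonionIsotope f) (OctonionIsotope f) where
  smul_comm r x y :=
    ((congrArg (fun t : Octonion => f.1 x * t) (map_smul f.1 r y)).trans
      (mul_smul_comm r (f.1 x) (f.1 y))).symm

/-- The involution `α • 1 + u ↦ α • 1 - u` of `𝕆^f`. -/
instance : StarRing (OctonionIsotope f) where
  star x := (star (show Octonion from x) : Octonion)
  star_involutive x := star_star (show Octonion from x)
  star_mul x y := by
    change star (f.1 x * f.1 y) = f.1 (star (show Octonion from y)) * f.1 (star (show Octonion from x))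
    rw [f.map_star, f.map_star, star_mul]
  star_add x y := star_add (show Octonion from x) (show Octonion from y)

instance : StarModule ℝ (OctonionIsotope f) where
  star_smul r x := star_smul r (show Octonion from x)

end OctonionIsotope

/-- The cracovian algebra `A_*` generated by a real algebra `A` with involution `*`: the space `A`
with the new product `x ⊙ y = x^* y`. (The norm of an absolute-valued algebra `A` is kept; it plays
no role for subalgebras and identities.) -/
def Cracovian (A : Type*) : Type _ := A

namespace Cracovian

variable (A : Type*) [NonUnitalNonAssocRing A] [StarRing A]

instance : AddCommGroup (Cracovian A) := inferInstanceAs (AddCommGroup A)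

instance : Mul (Cracovian A) :=
  ⟨fun x y => (star (show A from x) * (show A from y) : A)⟩

instance : NonUnitalNonAssocRing (Cracovian A) where
  __ := (inferInstance : AddCommGroup (Cracovian A))
  left_distrib x y z := mul_add (star (show A from x)) y z
  right_distrib x y z :=
    (congrArg (fun t : A => t * (show A from z)) (star_add (show A from x) y)).trans
      (add_mul (star (show A from x)) (star (show A from y)) z)
  zero_mul x := (congrArg (fun t : A => t * (show A from x)) (star_zero A)).trans (zero_mul _)
  mul_zero x := mul_zero (star (show A from x))

variable [Module ℝ A]

instance : Module ℝ (Cracovian A) := inferInstanceAs (Module ℝ A)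

instance [FiniteDimensional ℝ A] : FiniteDimensional ℝ (Cracovian A) :=
  inferInstanceAs (FiniteDimensional ℝ A)

instance [IsScalarTower ℝ A A] [StarModule ℝ A] : IsScalarTower ℝ (Cracovian A) (Cracovian A) where
  smul_assoc r x y := by
    change star (r • (show A from x)) * (show A from y) = r • (star (show A from x) * (show A from y))
    rw [star_smul, star_trivial, smul_mul_assoc]

instance [SMulCommClass ℝ A A] : SMulCommClass ℝ (Cracovian A) (Cracovian A) where
  smul_comm r x y := smul_comm r (star (show A from x)) (show A from y)

end Cracovian

/-- A finite-dimensional algebra `A` has degree `n` if `n` is the least natural number such that all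
subalgebras of `A` generated by a single element have dimension at most `n`. -/
def HasDegree (K A : Type*) [Field K] [NonUnitalNonAssocRing A] [Module K A]
    [IsScalarTower K A A] [SMulCommClass K A A] [FiniteDimensional K A] (n : ℕ) : Prop :=
  IsLeast {m : ℕ | ∀ x : A, Module.finrank K (NonUnitalAlgebra.adjoin K ({x} : Set A)) ≤ m} n

end

/-! Everything is reduced to the subspaces of `Octonion` that are unital subalgebras invariant under
`f`. A subalgebra of `𝕆^f` of dimension at least 2, or a nonzero subalgebra of the cracovian
algebra, contains `1`; multiplying by `1` shows that it is stable under `f`, and since `f` is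
bijective on it, it is closed under the octonion product. Conversely every invariant subalgebra is a
subalgebra of both algebras. So the absence of 4-dimensional subalgebras passes from `𝕆^f` to the
cracovian algebra.

An isometry without such subalgebras fixes `1` and `i` and rotates three planes by different angles:
an invariant subalgebra not contained in the span of `1` and `i` contains at least two of these
planes, so its dimension exceeds 4.

A 2-dimensional subalgebra comes from a real eigenvector `u` of `f` on the 7-dimensional space of
imaginary octonions. For the degree, a proper subalgebra of `𝕆` has dimension at most 4 and never 3.
If no single element generated everything, each `x` would generate at most a plane, so `f x` would
lie in the span of `1` and `x`, and the quaternions would be a 4-dimensional invariant subalgebra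
(`exists_isInvariantSubalgebra_finrank_eq_four`).

In the cracovian algebra, the square of `x` is `‖x‖²` times `1`. This gives the identity at once,
and makes the associator at `1 + u` an explicit nonzero combination of `1` and `u`. -/

noncomputable section

/-! ### Octonion arithmetic and the dimensions of subalgebras. -/

namespace Octonion

theorem inner_eq (x y : Octonion) :
    ⟪x, y⟫_ℝ = (x.fst * star y.fst).re + (x.snd * star y.snd).re :=
  (WithLp.prod_inner_apply (𝕜 := ℝ) (E := ℍ[ℝ]) (F := ℍ[ℝ]) x y).trans (by
    rw [Quaternion.inner_def, Quaternion.inner_def]; rfl)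

/-- This adjunction and its right-hand counterpart turn closure under products into orthogonality
relations, the source of the dimension counts. -/
theorem inner_mul_left (x y z : Octonion) : ⟪x * y, z⟫_ℝ = ⟪y, star x * z⟫_ℝ := by
  simp only [inner_eq, fst_mul, snd_mul, fst_star, snd_star, Quaternion.re_mul,
    Quaternion.imI_mul, Quaternion.imJ_mul, Quaternion.imK_mul, Quaternion.re_star,
    Quaternion.imI_star, Quaternion.imJ_star, Quaternion.imK_star, Quaternion.re_sub,
    Quaternion.imI_sub, Quaternion.imJ_sub, Quaternion.imK_sub, Quaternion.re_add,
    Quaternion.imI_add, Quaternion.imJ_add, Quaternion.imK_add, Quaternion.re_neg,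
    Quaternion.imI_neg, Quaternion.imJ_neg, Quaternion.imK_neg]
  ring

theorem inner_mul_right (x y z : Octonion) : ⟪x * y, z⟫_ℝ = ⟪x, z * star y⟫_ℝ := by
  simp only [inner_eq, fst_mul, snd_mul, fst_star, snd_star, Quaternion.re_mul,
    Quaternion.imI_mul, Quaternion.imJ_mul, Quaternion.imK_mul, Quaternion.re_star,
    Quaternion.imI_star, Quaternion.imJ_star, Quaternion.imK_star, Quaternion.re_sub,
    Quaternion.imI_sub, Quaternion.imJ_sub, Quaternion.imK_sub, Quaternion.re_add,
    Quaternion.imI_add, Quaternion.imJ_add, Quaternion.imK_add, Quaternion.re_neg,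
    Quaternion.imI_neg, Quaternion.imJ_neg, Quaternion.imK_neg]
  ring

theorem one_mul' (x : Octonion) : 1 * x = x := by ext1 <;> simp

theorem mul_one' (x : Octonion) : x * 1 = x := by ext1 <;> simp

theorem star_one' : star (1 : Octonion) = 1 := by ext1 <;> simp

theorem star_mul_self (x : Octonion) : star x * x = ⟪x, x⟫_ℝ • (1 : Octonion) := by
  rw [inner_eq]
  apply ext <;> ext <;> simp <;> ring

/-- The only consequence of alternativity that is needed: it excludes zero divisors. -/
theorem star_mul_mul (x y : Octonion) : star x * (x * y) = ⟪x, x⟫_ℝ • y := by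
  rw [inner_eq]
  apply ext <;> ext <;> simp <;> ring

theorem star_eq_neg {x : Octonion} (h : ⟪(1 : Octonion), x⟫_ℝ = 0) : star x = -x := by
  rw [star_eq, h]; simp

theorem mul_self_of_inner_one_eq_zero {x : Octonion} (h : ⟪(1 : Octonion), x⟫_ℝ = 0) :
    x * x = (-⟪x, x⟫_ℝ) • (1 : Octonion) := by
  have := star_mul_self x
  rw [star_eq_neg h, neg_mul] at this
  rw [neg_smul, ← this, neg_neg]

theorem one_ne_zero' : (1 : Octonion) ≠ 0 := fun h => by
  have := congrArg (fun x : Octonion => x.fst.re) h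
  simp at this

theorem mul_ne_zero' {x y : Octonion} (hx : x ≠ 0) (hy : y ≠ 0) : x * y ≠ 0 := by
  intro h
  have h1 := star_mul_mul x y
  rw [h, mul_zero] at h1
  exact (smul_ne_zero (inner_self_ne_zero.2 hx) hy) h1.symm

theorem finrank_eq : Module.finrank ℝ Octonion = 8 := by
  have : Module.finrank ℝ Octonion = Module.finrank ℝ (ℍ[ℝ] × ℍ[ℝ]) :=
    (WithLp.linearEquiv 2 ℝ (ℍ[ℝ] × ℍ[ℝ])).finrank_eq
  rw [this, Module.finrank_prod, Quaternion.finrank_eq_four]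

theorem card_le_finrank {n : ℕ} (S : Submodule ℝ Octonion) (v : Fin n → Octonion)
    (hS : ∀ i, v i ∈ S) (h0 : ∀ i, v i ≠ 0) (ho : Pairwise fun i j => ⟪v i, v j⟫_ℝ = 0) :
    n ≤ Module.finrank ℝ S := by
  have h : LinearIndependent ℝ v := linearIndependent_of_ne_zero_of_inner_eq_zero h0 ho
  have h' : LinearIndependent ℝ (fun i => (⟨v i, hS i⟩ : S)) :=
    LinearIndependent.of_comp S.subtype h
  simpa using h'.fintype_card_le_finrank

theorem finrank_span_pair_le (a b : Octonion) :
    Module.finrank ℝ (Submodule.span ℝ ({a, b} : Set Octonion)) ≤ 2 := by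
  classical
  have := finrank_span_finset_le_card (R := ℝ) ({a, b} : Finset Octonion)
  rw [Finset.coe_pair] at this
  exact this.trans Finset.card_le_two

/-- Unital subalgebras of the octonions, as subspaces. -/
structure IsSubalgebra (S : Submodule ℝ Octonion) : Prop where
  one_mem : (1 : Octonion) ∈ S
  mul_mem : ∀ {x y}, x ∈ S → y ∈ S → x * y ∈ S

namespace IsSubalgebra

variable {S : Submodule ℝ Octonion}

theorem star_mem (h : IsSubalgebra S) {x : Octonion} (hx : x ∈ S) : star x ∈ S := by
  rw [star_eq]
  exact S.sub_mem (S.smul_mem _ h.one_mem) hx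

/-- A proper subalgebra has dimension at most `4`: multiplication by a nonzero vector of its
orthogonal complement embeds it into the orthogonal complement. -/
theorem eq_top_or_finrank_le (h : IsSubalgebra S) : S = ⊤ ∨ Module.finrank ℝ S ≤ 4 := by
  by_cases hS : S = ⊤
  · exact Or.inl hS
  right
  have hb : Sᗮ ≠ ⊥ := fun hb => hS (Submodule.orthogonal_eq_bot_iff.1 hb)
  obtain ⟨w, hw, hw0⟩ := Submodule.exists_mem_ne_zero_of_ne_bot hb
  have hle : Submodule.map (LinearMap.mulRight ℝ w) S ≤ Sᗮ := by
    rintro _ ⟨s, hs, rfl⟩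
    rw [Submodule.mem_orthogonal']
    intro t ht
    rw [LinearMap.mulRight_apply, inner_mul_left]
    exact (Submodule.mem_orthogonal' _ _).1 hw _ (h.mul_mem (h.star_mem hs) ht)
  have hinj : Function.Injective (LinearMap.mulRight ℝ w) := by
    rw [← LinearMap.ker_eq_bot, LinearMap.ker_eq_bot']
    intro x hx
    by_contra hx0
    exact mul_ne_zero' hx0 hw0 hx
  have h1 := Submodule.finrank_mono hle
  rw [← (Submodule.equivMapOfInjective _ hinj S).finrank_eq] at h1
  have h2 := S.finrank_add_finrank_orthogonal
  rw [finrank_eq] at h2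
  omega

/-- A subalgebra of dimension at least `3` has dimension at least `4`: with two orthogonal imaginary
vectors, it contains their product, which is orthogonal to both and to `1`. -/
theorem four_le_finrank (h : IsSubalgebra S) (h3 : 3 ≤ Module.finrank ℝ S) :
    4 ≤ Module.finrank ℝ S := by
  -- Since `Kᗮ` has dimension at least 6 and `S` at least 3, they meet nontrivially in dimension 8.
  have key : ∀ K : Submodule ℝ Octonion, Module.finrank ℝ K ≤ 2 → ∃ x ∈ S, x ≠ 0 ∧ x ∈ Kᗮ := by
    intro K hK
    have h1 := Submodule.finrank_sup_add_finrank_inf_eq S Kᗮ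
    have h4 := (S ⊔ Kᗮ).finrank_le
    have h2 := K.finrank_add_finrank_orthogonal
    rw [finrank_eq] at h2 h4
    have h3 : S ⊓ Kᗮ ≠ ⊥ := by
      intro hb
      rw [hb, finrank_bot] at h1
      omega
    obtain ⟨x, hx, hx0⟩ := Submodule.exists_mem_ne_zero_of_ne_bot h3
    exact ⟨x, hx.1, hx0, hx.2⟩
  -- The pair `1, 1` stands for the line spanned by `1`.
  obtain ⟨u, huS, hu0, hu⟩ := key _ (finrank_span_pair_le 1 1)
  obtain ⟨v, hvS, hv0, hv⟩ := key _ (finrank_span_pair_le 1 u)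
  have hu1 : ⟪(1 : Octonion), u⟫_ℝ = 0 := hu _ (Submodule.subset_span (by simp))
  have hv1 : ⟪(1 : Octonion), v⟫_ℝ = 0 := hv _ (Submodule.subset_span (by simp))
  have huv : ⟪u, v⟫_ℝ = 0 := hv _ (Submodule.subset_span (by simp))
  have hw1 : ⟪u * v, 1⟫_ℝ = 0 := by
    rw [inner_mul_left, mul_one', star_eq_neg hu1, inner_neg_right, real_inner_comm, huv, neg_zero]
  have hwu : ⟪u * v, u⟫_ℝ = 0 := by
    rw [inner_mul_left, star_mul_self, inner_smul_right, real_inner_comm 1 v, hv1, mul_zero]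
  have hwv : ⟪u * v, v⟫_ℝ = 0 := by
    rw [inner_mul_right, ← star_star v, star_star (star v), star_mul_self, inner_smul_right,
      real_inner_comm 1 u, hu1, mul_zero]
  refine card_le_finrank S ![1, u, v, u * v] ?_ ?_ ?_
  · intro i
    fin_cases i
    exacts [h.one_mem, huS, hvS, h.mul_mem huS hvS]
  · intro i
    fin_cases i
    exacts [one_ne_zero', hu0, hv0, mul_ne_zero' hu0 hv0]
  · intro i j hij
    have e1 := real_inner_comm (1 : Octonion) u
    have e2 := real_inner_comm (1 : Octonion) v
    have e3 := real_inner_comm u v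
    have e4 := real_inner_comm (u * v) 1
    have e5 := real_inner_comm (u * v) u
    have e6 := real_inner_comm (u * v) v
    fin_cases i <;> fin_cases j <;> simp_all

end IsSubalgebra

end Octonion

/-! ### Invariant subalgebras, and subalgebras of the isotope and of the cracovian algebra. -/

namespace OctonionIsometry

/-- Unital subalgebras of the octonions that are invariant under the isometry `f`. -/
structure IsInvariantSubalgebra (f : OctonionIsometry) (S : Submodule ℝ Octonion) : Prop
    extends Octonion.IsSubalgebra S where
  map_mem : ∀ {x}, x ∈ S → f.1 x ∈ S

variable (f : OctonionIsometry)

theorem inner_one_map (x : Octonion) : ⟪(1 : Octonion), f.1 x⟫_ℝ = ⟪(1 : Octonion), x⟫_ℝ := by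
  have h := f.1.inner_map_map 1 x
  rwa [f.2] at h

theorem map_ne_zero {x : Octonion} (hx : x ≠ 0) : f.1 x ≠ 0 := fun h =>
  hx (f.1.injective (h.trans (map_zero f.1).symm))

/-- An injective endomorphism of a finite-dimensional space is onto. This removes `f` from the
products: closure under `f x * f y` becomes closure under `x * y`. -/
theorem exists_mem_map_eq {S : Submodule ℝ Octonion} (h : ∀ x ∈ S, f.1 x ∈ S) {y : Octonion}
    (hy : y ∈ S) : ∃ x ∈ S, f.1 x = y := by
  have hle : S.map f.1.toLinearMap ≤ S := by
    rintro _ ⟨x, hx, rfl⟩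
    exact h x hx
  have heq : S.map f.1.toLinearMap = S := Submodule.eq_of_le_of_finrank_eq hle
    (Submodule.equivMapOfInjective f.1.toLinearMap f.1.injective S).finrank_eq.symm
  rw [← heq] at hy
  exact hy

end OctonionIsometry

namespace OctonionIsotope

variable {f : OctonionIsometry}

/-- The octonion subspace underlying a subalgebra of `𝕆^f`. -/
def toOctonion (S : NonUnitalSubalgebra ℝ (OctonionIsotope f)) : Submodule ℝ Octonion where
  carrier := {x : Octonion | (show OctonionIsotope f from x) ∈ S}
  add_mem' := S.add_mem
  zero_mem' := S.zero_mem
  smul_mem' r _ h := S.smul_mem r h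

theorem finrank_toOctonion (S : NonUnitalSubalgebra ℝ (OctonionIsotope f)) :
    Module.finrank ℝ (toOctonion S) = Module.finrank ℝ S := rfl

/-- Dimension 2 ensures a nonzero imaginary element, whose square in `𝕆^f` is a nonzero multiple of
`1`. A line may be spanned by another idempotent. -/
theorem isInvariantSubalgebra_toOctonion (S : NonUnitalSubalgebra ℝ (OctonionIsotope f))
    (hS : 2 ≤ Module.finrank ℝ S) : f.IsInvariantSubalgebra (toOctonion S) := by
  have hmul : ∀ x ∈ toOctonion S, ∀ y ∈ toOctonion S, f.1 x * f.1 y ∈ toOctonion S :=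
    fun x hx y hy => S.mul_mem hx hy
  rw [← finrank_toOctonion] at hS
  generalize toOctonion S = T at hS hmul
  have h1 : (1 : Octonion) ∈ T := by
    have hne : T ⊓ (Submodule.span ℝ {(1 : Octonion)})ᗮ ≠ ⊥ := by
      intro hb
      have e1 := Submodule.finrank_sup_add_finrank_inf_eq T (Submodule.span ℝ {(1 : Octonion)})ᗮ
      have e2 := (T ⊔ (Submodule.span ℝ {(1 : Octonion)})ᗮ).finrank_le
      have e3 := (Submodule.span ℝ {(1 : Octonion)}).finrank_add_finrank_orthogonal
      rw [finrank_span_singleton Octonion.one_ne_zero'] at e3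
      rw [hb, finrank_bot] at e1
      omega
    obtain ⟨x, ⟨hxT, hx⟩, hx0⟩ := Submodule.exists_mem_ne_zero_of_ne_bot hne
    have hx1 : ⟪(1 : Octonion), f.1 x⟫_ℝ = 0 := by
      rw [f.inner_one_map]
      exact hx _ (Submodule.mem_span_singleton_self _)
    have h2 := hmul x hxT x hxT
    rw [Octonion.mul_self_of_inner_one_eq_zero hx1] at h2
    exact (T.smul_mem_iff (neg_ne_zero.2 (inner_self_ne_zero.2 (f.map_ne_zero hx0)))).1 h2
  have hmap : ∀ x ∈ T, f.1 x ∈ T := by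
    intro x hx
    have h2 := hmul 1 h1 x hx
    rwa [f.2, Octonion.one_mul'] at h2
  refine ⟨⟨h1, ?_⟩, fun hx => hmap _ hx⟩
  intro x y hx hy
  obtain ⟨x', hx', rfl⟩ := f.exists_mem_map_eq hmap hx
  obtain ⟨y', hy', rfl⟩ := f.exists_mem_map_eq hmap hy
  exact hmul x' hx' y' hy'

theorem exists_subalgebra_finrank_eq {T : Submodule ℝ Octonion} (hT : f.IsInvariantSubalgebra T) :
    ∃ S : NonUnitalSubalgebra ℝ (OctonionIsotope f), Module.finrank ℝ S = Module.finrank ℝ T :=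
  ⟨{ carrier := {x | (show Octonion from x) ∈ T}
     add_mem' := T.add_mem
     zero_mem' := T.zero_mem
     mul_mem' := fun hx hy => hT.mul_mem (hT.map_mem hx) (hT.map_mem hy)
     smul_mem' := fun r _ h => T.smul_mem r h }, rfl⟩

end OctonionIsotope

namespace Cracovian

variable {f : OctonionIsometry}

/-- The octonion subspace underlying a subalgebra of `(𝕆^f)_*`. -/
def toOctonion (S : NonUnitalSubalgebra ℝ (Cracovian (OctonionIsotope f))) :
    Submodule ℝ Octonion where
  carrier := {x : Octonion | (show Cracovian (OctonionIsotope f) from x) ∈ S}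
  add_mem' := S.add_mem
  zero_mem' := S.zero_mem
  smul_mem' r _ h := S.smul_mem r h

theorem finrank_toOctonion (S : NonUnitalSubalgebra ℝ (Cracovian (OctonionIsotope f))) :
    Module.finrank ℝ (toOctonion S) = Module.finrank ℝ S := rfl

theorem mul_eq (x y : Octonion) :
    ((show Cracovian (OctonionIsotope f) from x) * (show Cracovian (OctonionIsotope f) from y) :
      Cracovian (OctonionIsotope f)) = (star (f.1 x) * f.1 y : Octonion) := by
  rw [← f.map_star]
  rfl

/-- Here any nonzero element has a nonzero multiple of `1` as its square, so no bound on the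
dimension is needed. -/
theorem isInvariantSubalgebra_toOctonion (S : NonUnitalSubalgebra ℝ (Cracovian (OctonionIsotope f)))
    (hS : toOctonion S ≠ ⊥) : f.IsInvariantSubalgebra (toOctonion S) := by
  have hmul : ∀ x ∈ toOctonion S, ∀ y ∈ toOctonion S, star (f.1 x) * f.1 y ∈ toOctonion S := by
    intro x hx y hy
    have h : (show Cracovian (OctonionIsotope f) from x) *
      (show Cracovian (OctonionIsotope f) from y) ∈ S := S.mul_mem hx hy
    rw [mul_eq] at h
    exact h
  generalize toOctonion S = T at hS hmul
  obtain ⟨x, hxT, hx0⟩ := Submodule.exists_mem_ne_zero_of_ne_bot hS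
  have h1 : (1 : Octonion) ∈ T := by
    have h2 := hmul x hxT x hxT
    rw [Octonion.star_mul_self] at h2
    exact (T.smul_mem_iff (inner_self_ne_zero.2 (f.map_ne_zero hx0))).1 h2
  have hmap : ∀ x ∈ T, f.1 x ∈ T := by
    intro x hx
    have h2 := hmul 1 h1 x hx
    rwa [f.2, Octonion.star_one', Octonion.one_mul'] at h2
  refine ⟨⟨h1, ?_⟩, fun hx => hmap _ hx⟩
  intro x y hx hy
  have hx' : star x ∈ T := by
    rw [Octonion.star_eq]
    exact T.sub_mem (T.smul_mem _ h1) hx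
  -- The factor `z` is chosen so that the conjugation in the cracovian product restores `x`.
  obtain ⟨z, hz, hzx⟩ := f.exists_mem_map_eq hmap hx'
  obtain ⟨y', hy', rfl⟩ := f.exists_mem_map_eq hmap hy
  have := hmul z hz y' hy'
  rwa [hzx, star_star] at this

theorem exists_subalgebra_finrank_eq {T : Submodule ℝ Octonion} (hT : f.IsInvariantSubalgebra T) :
    ∃ S : NonUnitalSubalgebra ℝ (Cracovian (OctonionIsotope f)),
      Module.finrank ℝ S = Module.finrank ℝ T :=
  ⟨{ carrier := {x | (show Octonion from x) ∈ T}
     add_mem' := T.add_mem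
     zero_mem' := T.zero_mem
     mul_mem' := fun {x y} hx hy => by
      have h : star (f.1 (show Octonion from x)) * f.1 (show Octonion from y) ∈ T :=
        hT.mul_mem (hT.star_mem (hT.map_mem hx)) (hT.map_mem hy)
      exact Set.mem_of_eq_of_mem (mul_eq (f := f) x y) h
     smul_mem' := fun r _ h => T.smul_mem r h }, rfl⟩

end Cracovian

/-! ### An isometry with no 4-dimensional invariant subalgebra. -/

namespace Octonion

@[simp] theorem fst_neg (x : Octonion) : (-x).fst = -x.fst := rfl
@[simp] theorem snd_neg (x : Octonion) : (-x).snd = -x.snd := rfl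

/-- The quaternion with the given coordinates. -/
def quat (a b c d : ℝ) : ℍ[ℝ] := ⟨a, b, c, d⟩

@[simp] theorem quat_re (a b c d : ℝ) : (quat a b c d).re = a := rfl
@[simp] theorem quat_imI (a b c d : ℝ) : (quat a b c d).imI = b := rfl
@[simp] theorem quat_imJ (a b c d : ℝ) : (quat a b c d).imJ = c := rfl
@[simp] theorem quat_imK (a b c d : ℝ) : (quat a b c d).imK = d := rfl

/-- The direct sum of the identity of the span of `1` and `i` and of three rotations by different
angles, of the planes spanned by `j, l`, by `k, jl` and by `il, kl`. -/
def planeRotations : Octonion →ₗ[ℝ] Octonion where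
  toFun x := mk
    (quat x.fst.re x.fst.imI (-x.snd.re) (3 / 5 * x.fst.imK - 4 / 5 * x.snd.imJ))
    (quat x.fst.imJ (-3 / 5 * x.snd.imI - 4 / 5 * x.snd.imK) (4 / 5 * x.fst.imK + 3 / 5 * x.snd.imJ)
      (4 / 5 * x.snd.imI - 3 / 5 * x.snd.imK))
  map_add' x y := by apply ext <;> ext <;> simp <;> ring
  map_smul' r x := by apply ext <;> ext <;> simp <;> ring

theorem planeRotations_apply (x : Octonion) : planeRotations x = mk
    (quat x.fst.re x.fst.imI (-x.snd.re) (3 / 5 * x.fst.imK - 4 / 5 * x.snd.imJ))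
    (quat x.fst.imJ (-3 / 5 * x.snd.imI - 4 / 5 * x.snd.imK) (4 / 5 * x.fst.imK + 3 / 5 * x.snd.imJ)
      (4 / 5 * x.snd.imI - 3 / 5 * x.snd.imK)) := rfl

theorem norm_planeRotations (x : Octonion) : ‖planeRotations x‖ = ‖x‖ := by
  rw [← sq_eq_sq₀ (norm_nonneg _) (norm_nonneg _), ← real_inner_self_eq_norm_sq,
    ← real_inner_self_eq_norm_sq, inner_eq, inner_eq, planeRotations_apply]
  simp
  ring

theorem planeRotations_one : planeRotations 1 = 1 := by
  rw [planeRotations_apply]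
  apply ext <;> ext <;> simp

/-- If `p` and its image `q` under a rotation of the plane of `a` and `b` lie in a subspace, then so
do `a` and `b`, unless `p = 0`. -/
theorem mem_of_rotation {S : Submodule ℝ Octonion} {a b : Octonion} {x y c s : ℝ} (hs : s ≠ 0)
    (hxy : x ≠ 0 ∨ y ≠ 0) (hp : x • a + y • b ∈ S)
    (hq : (c * x - s * y) • a + (s * x + c * y) • b ∈ S) : a ∈ S ∧ b ∈ S := by
  -- Removing `c` times `p` from `q` and dividing by `s` leaves `p` turned by a right angle; with
  -- `p` it spans the plane.
  have hr : (-y) • a + x • b ∈ S := by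
    have h := S.smul_mem s⁻¹ (S.sub_mem hq (S.smul_mem c hp))
    convert h using 1
    match_scalars <;> field_simp <;> ring
  have hn : x ^ 2 + y ^ 2 ≠ 0 := by
    rcases hxy with h | h <;> positivity
  constructor
  · have h := S.smul_mem (x ^ 2 + y ^ 2)⁻¹ (S.sub_mem (S.smul_mem x hp) (S.smul_mem y hr))
    convert h using 1
    match_scalars <;> field_simp <;> ring
  · have h := S.smul_mem (x ^ 2 + y ^ 2)⁻¹ (S.add_mem (S.smul_mem y hp) (S.smul_mem x hr))
    convert h using 1
    match_scalars <;> field_simp <;> ring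

/-- The polynomial of a rotation with cosine `c`, evaluated at `planeRotations`. -/
def rotationPolynomial (c : ℝ) (x : Octonion) : Octonion :=
  planeRotations (planeRotations x) - (2 * c) • planeRotations x + x

theorem rotationPolynomial_mem {S : Submodule ℝ Octonion} (h : ∀ x ∈ S, planeRotations x ∈ S)
    (c : ℝ) {x : Octonion} (hx : x ∈ S) : rotationPolynomial c x ∈ S :=
  S.add_mem (S.sub_mem (h _ (h _ hx)) (S.smul_mem _ (h _ hx))) hx


/-- By Cayley–Hamilton, on the plane rotated with cosine `c'` the polynomial acts as `2 * (c' - c)`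
times the rotation. It therefore kills exactly the plane of cosine `c`; the three cosines are `0`,
`3 / 5` and `-3 / 5`. -/
theorem rotationPolynomial_apply (c : ℝ) (x : Octonion) : rotationPolynomial c x = mk
    (quat ((2 - 2 * c) * x.fst.re) ((2 - 2 * c) * x.fst.imI) (2 * c * x.snd.re)
      ((6 / 5 - 2 * c) * (3 / 5 * x.fst.imK - 4 / 5 * x.snd.imJ)))
    (quat (-2 * c * x.fst.imJ) ((-6 / 5 - 2 * c) * (-3 / 5 * x.snd.imI - 4 / 5 * x.snd.imK))
      ((6 / 5 - 2 * c) * (4 / 5 * x.fst.imK + 3 / 5 * x.snd.imJ))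
      ((-6 / 5 - 2 * c) * (4 / 5 * x.snd.imI - 3 / 5 * x.snd.imK))) := by
  simp only [rotationPolynomial, planeRotations_apply]
  apply ext <;> ext <;> simp <;> ring

/-- Subtracting `x` from its image kills the span of `1` and `i`, and two rotation polynomials kill
the other two planes. What survives is an invertible image of the component of `x` in the remaining
plane. The next two lemmas use the same filter for the other planes. -/
theorem mem_of_fst_imJ_or_snd_re {S : Submodule ℝ Octonion}
    (h : ∀ x ∈ S, planeRotations x ∈ S) {x : Octonion} (hx : x ∈ S)
    (hx0 : x.fst.imJ ≠ 0 ∨ x.snd.re ≠ 0) :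
    mk (quat 0 0 1 0) 0 ∈ S ∧ mk 0 (quat 1 0 0 0) ∈ S := by
  have hp := rotationPolynomial_mem h (3 / 5) (rotationPolynomial_mem h (-3 / 5)
    (S.sub_mem (h x hx) hx))
  have hq := h _ hp
  set p := rotationPolynomial (3 / 5) (rotationPolynomial (-3 / 5) (planeRotations x - x)) with hpx
  have h0 : p = p.fst.imJ • mk (quat 0 0 1 0) 0 + p.snd.re • mk 0 (quat 1 0 0 0) := by
    rw [hpx, rotationPolynomial_apply, rotationPolynomial_apply, planeRotations_apply]
    apply ext <;> ext <;> norm_num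
  refine mem_of_rotation (x := p.fst.imJ) (y := p.snd.re) (c := 0) (s := 1)
    (by norm_num) ?_ (h0 ▸ hp) ?_
  · by_contra! hc
    rw [hpx, rotationPolynomial_apply, rotationPolynomial_apply, planeRotations_apply] at hc
    norm_num at hc
    rcases hx0 with h0 | h0 <;> apply h0 <;> linarith [hc.1, hc.2]
  · convert hq using 1
    rw [planeRotations_apply, h0]
    apply ext <;> ext <;> simp

theorem mem_of_fst_imK_or_snd_imJ {S : Submodule ℝ Octonion}
    (h : ∀ x ∈ S, planeRotations x ∈ S) {x : Octonion} (hx : x ∈ S)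
    (hx0 : x.fst.imK ≠ 0 ∨ x.snd.imJ ≠ 0) :
    mk (quat 0 0 0 1) 0 ∈ S ∧ mk 0 (quat 0 0 1 0) ∈ S := by
  have hp := rotationPolynomial_mem h 0 (rotationPolynomial_mem h (-3 / 5)
    (S.sub_mem (h x hx) hx))
  have hq := h _ hp
  set p := rotationPolynomial 0 (rotationPolynomial (-3 / 5) (planeRotations x - x)) with hpx
  have h0 : p = p.fst.imK • mk (quat 0 0 0 1) 0 + p.snd.imJ • mk 0 (quat 0 0 1 0) := by
    rw [hpx, rotationPolynomial_apply, rotationPolynomial_apply, planeRotations_apply]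
    apply ext <;> ext <;> norm_num
  refine mem_of_rotation (x := p.fst.imK) (y := p.snd.imJ) (c := 3 / 5) (s := 4 / 5)
    (by norm_num) ?_ (h0 ▸ hp) ?_
  · by_contra! hc
    rw [hpx, rotationPolynomial_apply, rotationPolynomial_apply, planeRotations_apply] at hc
    norm_num at hc
    rcases hx0 with h0 | h0 <;> apply h0 <;> linarith [hc.1, hc.2]
  · convert hq using 1
    rw [planeRotations_apply, h0]
    apply ext <;> ext <;> simp

theorem mem_of_snd_imI_or_snd_imK {S : Submodule ℝ Octonion}
    (h : ∀ x ∈ S, planeRotations x ∈ S) {x : Octonion} (hx : x ∈ S)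
    (hx0 : x.snd.imI ≠ 0 ∨ x.snd.imK ≠ 0) :
    mk 0 (quat 0 1 0 0) ∈ S ∧ mk 0 (quat 0 0 0 1) ∈ S := by
  have hp := rotationPolynomial_mem h 0 (rotationPolynomial_mem h (3 / 5)
    (S.sub_mem (h x hx) hx))
  have hq := h _ hp
  set p := rotationPolynomial 0 (rotationPolynomial (3 / 5) (planeRotations x - x)) with hpx
  have h0 : p = p.snd.imI • mk 0 (quat 0 1 0 0) + p.snd.imK • mk 0 (quat 0 0 0 1) := by
    rw [hpx, rotationPolynomial_apply, rotationPolynomial_apply, planeRotations_apply]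
    apply ext <;> ext <;> norm_num
  refine mem_of_rotation (x := p.snd.imI) (y := p.snd.imK) (c := -3 / 5) (s := 4 / 5)
    (by norm_num) ?_ (h0 ▸ hp) ?_
  · by_contra! hc
    rw [hpx, rotationPolynomial_apply, rotationPolynomial_apply, planeRotations_apply] at hc
    norm_num at hc
    rcases hx0 with h0 | h0 <;> apply h0 <;> linarith [hc.1, hc.2]
  · convert hq using 1
    rw [planeRotations_apply, h0]
    apply ext <;> ext <;> simp
    ring

/-- A subalgebra invariant under `planeRotations` does not have dimension `4`: it lies in the span
of `1` and `i`, or it contains two of the three planes. -/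
theorem finrank_ne_four_of_planeRotations {S : Submodule ℝ Octonion} (hS : IsSubalgebra S)
    (h : ∀ x ∈ S, planeRotations x ∈ S) : Module.finrank ℝ S ≠ 4 := by
  intro h4
  have hfive : ∀ v : Fin 5 → Octonion, (∀ i, v i ∈ S) → (∀ i, v i ≠ 0) →
      (Pairwise fun i j => ⟪v i, v j⟫_ℝ = 0) → False := by
    intro v h1 h2 h3
    have := card_le_finrank S v h1 h2 h3
    omega
  have hne : ∀ x : Octonion, (x.fst * star x.fst).re + (x.snd * star x.snd).re = 1 → x ≠ 0 := by
    rintro x hx rfl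
    simp at hx
  by_cases h1 : ∃ x ∈ S, x.fst.imJ ≠ 0 ∨ x.snd.re ≠ 0
  · obtain ⟨x, hx, hx0⟩ := h1
    obtain ⟨ha, hb⟩ := mem_of_fst_imJ_or_snd_re h hx hx0
    -- The product of the two basis vectors of a plane lies in the next plane, in cyclic order, so
    -- one plane in `S` brings in another.
    obtain ⟨hc, hd⟩ := mem_of_fst_imK_or_snd_imJ h (hS.mul_mem ha hb) (Or.inr (by simp))
    refine hfive ![1, mk (quat 0 0 1 0) 0, mk 0 (quat 1 0 0 0), mk (quat 0 0 0 1) 0,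
      mk 0 (quat 0 0 1 0)]
      ?_ ?_ ?_
    · intro i
      fin_cases i
      exacts [hS.one_mem, ha, hb, hc, hd]
    · intro i
      apply hne
      fin_cases i <;> simp
    · intro i j hij
      fin_cases i <;> fin_cases j <;> simp [inner_eq] at hij ⊢
  by_cases h2 : ∃ x ∈ S, x.fst.imK ≠ 0 ∨ x.snd.imJ ≠ 0
  · obtain ⟨x, hx, hx0⟩ := h2
    obtain ⟨ha, hb⟩ := mem_of_fst_imK_or_snd_imJ h hx hx0
    obtain ⟨hc, hd⟩ := mem_of_snd_imI_or_snd_imK h (hS.mul_mem ha hb) (Or.inl (by simp))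
    refine hfive ![1, mk (quat 0 0 0 1) 0, mk 0 (quat 0 0 1 0), mk 0 (quat 0 1 0 0),
      mk 0 (quat 0 0 0 1)]
      ?_ ?_ ?_
    · intro i
      fin_cases i
      exacts [hS.one_mem, ha, hb, hc, hd]
    · intro i
      apply hne
      fin_cases i <;> simp
    · intro i j hij
      fin_cases i <;> fin_cases j <;> simp [inner_eq] at hij ⊢
  by_cases h3 : ∃ x ∈ S, x.snd.imI ≠ 0 ∨ x.snd.imK ≠ 0
  · obtain ⟨x, hx, hx0⟩ := h3
    obtain ⟨ha, hb⟩ := mem_of_snd_imI_or_snd_imK h hx hx0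
    exact h1 ⟨_, hS.mul_mem ha hb, Or.inl (by simp)⟩
  push Not at h1 h2 h3
  have hle : S ≤ Submodule.span ℝ ({1, mk (quat 0 1 0 0) 0} : Set Octonion) := by
    intro x hx
    rw [Submodule.mem_span_pair]
    refine ⟨x.fst.re, x.fst.imI, ?_⟩
    apply ext <;> ext <;> simp [h1 x hx, h2 x hx, h3 x hx]
  have h5 := (Submodule.finrank_mono hle).trans (finrank_span_pair_le _ _)
  omega

end Octonion

/-! ### Imaginary eigenvectors and small invariant subalgebras. -/

open Filter Polynomial in
-- The characteristic polynomial has odd degree, so the intermediate value theorem gives it a real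
-- root. Its behaviour at `-∞` is read off from the composition with `-X`.
theorem Module.End.exists_hasEigenvalue_of_odd_finrank {V : Type*} [AddCommGroup V] [Module ℝ V]
    [FiniteDimensional ℝ V] (g : Module.End ℝ V) (h : Odd (Module.finrank ℝ V)) :
    ∃ μ : ℝ, g.HasEigenvalue μ := by
  have hm : g.charpoly.Monic := LinearMap.charpoly_monic g
  have hd : g.charpoly.natDegree = Module.finrank ℝ V := LinearMap.charpoly_natDegree g
  have hX : (-X : ℝ[X]).natDegree = 1 := by simp
  have h1 := g.charpoly.tendsto_atTop_of_leadingCoeff_nonneg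
    (natDegree_pos_iff_degree_pos.1 (by rw [hd]; exact h.pos)) (by rw [hm.leadingCoeff]; simp)
  have h2 := (g.charpoly.comp (-X)).tendsto_atBot_of_leadingCoeff_nonpos
    (natDegree_pos_iff_degree_pos.1 (by rw [natDegree_comp, hd, hX, mul_one]; exact h.pos))
    (by
      rw [leadingCoeff_comp (by rw [hX]; exact one_ne_zero), hm.leadingCoeff, hd,
        leadingCoeff_neg, leadingCoeff_X, h.neg_one_pow]
      norm_num)
  obtain ⟨b, hb⟩ := (h1.eventually_ge_atTop 0).exists
  obtain ⟨a, ha⟩ := (h2.eventually_le_atBot 0).exists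
  obtain ⟨μ, hμ⟩ := mem_range_of_exists_le_of_exists_ge g.charpoly.continuous
    ⟨-a, by simpa using ha⟩ ⟨b, hb⟩
  exact ⟨μ, (Module.End.hasEigenvalue_iff_isRoot_charpoly g μ).2 hμ⟩

namespace OctonionIsometry

variable (f : OctonionIsometry)

theorem exists_imaginary_eigenvector :
    ∃ (u : Octonion) (μ : ℝ), u ≠ 0 ∧ ⟪(1 : Octonion), u⟫_ℝ = 0 ∧ f.1 u = μ • u := by
  let W : Submodule ℝ Octonion := (Submodule.span ℝ {(1 : Octonion)})ᗮ
  have hW : ∀ x, x ∈ W ↔ ⟪(1 : Octonion), x⟫_ℝ = 0 := fun x =>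
    Submodule.mem_orthogonal_singleton_iff_inner_right
  have hdim : Module.finrank ℝ W = 7 := by
    have e := (Submodule.span ℝ {(1 : Octonion)}).finrank_add_finrank_orthogonal
    rw [finrank_span_singleton Octonion.one_ne_zero', Octonion.finrank_eq] at e
    change 1 + Module.finrank ℝ W = 8 at e
    omega
  have hf : ∀ x ∈ W, f.1.toLinearMap x ∈ W := by
    intro x hx
    rw [hW] at hx ⊢
    exact (f.inner_one_map x).trans hx
  obtain ⟨μ, hμ⟩ := Module.End.exists_hasEigenvalue_of_odd_finrank
    (f.1.toLinearMap.restrict hf) (by rw [hdim]; decide)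
  obtain ⟨u, hu⟩ := hμ.exists_hasEigenvector
  exact ⟨u, μ, fun h => hu.2 (Subtype.ext h), (hW _).1 u.2, congrArg Subtype.val hu.apply_eq_smul⟩

/-- The span of `1` and an imaginary eigenvector `u` is closed under products because `u * u` is a
real multiple of `1`. -/
theorem exists_isInvariantSubalgebra_finrank_eq_two :
    ∃ T, f.IsInvariantSubalgebra T ∧ Module.finrank ℝ T = 2 := by
  obtain ⟨u, μ, hu0, hu1, hfu⟩ := f.exists_imaginary_eigenvector
  refine ⟨Submodule.span ℝ {1, u}, ⟨⟨Submodule.subset_span (by simp), ?_⟩, ?_⟩, ?_⟩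
  · intro x y hx hy
    obtain ⟨a, b, rfl⟩ := Submodule.mem_span_pair.1 hx
    obtain ⟨c, d, rfl⟩ := Submodule.mem_span_pair.1 hy
    refine Submodule.mem_span_pair.2 ⟨a * c - b * d * ⟪u, u⟫_ℝ, a * d + b * c, ?_⟩
    simp only [mul_add, add_mul, smul_mul_assoc, mul_smul_comm, Octonion.one_mul',
      Octonion.mul_one', Octonion.mul_self_of_inner_one_eq_zero hu1]
    module
  · intro x hx
    obtain ⟨a, b, rfl⟩ := Submodule.mem_span_pair.1 hx
    refine Submodule.mem_span_pair.2 ⟨a, b * μ, ?_⟩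
    rw [map_add, map_smul, map_smul, f.2, hfu, smul_smul]
  · refine le_antisymm (Octonion.finrank_span_pair_le _ _)
      (Octonion.card_le_finrank _ ![1, u] ?_ ?_ ?_)
    · intro i
      fin_cases i <;> exact Submodule.subset_span (by simp)
    · intro i
      fin_cases i
      exacts [Octonion.one_ne_zero', hu0]
    · intro i j hij
      have := real_inner_comm (1 : Octonion) u
      fin_cases i <;> fin_cases j <;> simp_all

/-- An isometry that maps every octonion `x` into the span of `1` and `x` leaves the quaternions
invariant. -/
theorem exists_isInvariantSubalgebra_finrank_eq_four
    (h : ∀ x, f.1 x ∈ Submodule.span ℝ {1, x}) :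
    ∃ T, f.IsInvariantSubalgebra T ∧ Module.finrank ℝ T = 4 := by
  let ι : ℍ[ℝ] →ₗ[ℝ] Octonion :=
    { toFun := fun a => Octonion.mk a 0
      map_add' := fun a b => by ext1 <;> simp
      map_smul' := fun r a => by ext1 <;> simp }
  have hι : Function.Injective ι := fun a b hab => congrArg Octonion.fst hab
  have h1 : (1 : Octonion) ∈ LinearMap.range ι := ⟨1, rfl⟩
  refine ⟨LinearMap.range ι, ⟨⟨h1, ?_⟩, ?_⟩, ?_⟩
  · rintro _ _ ⟨a, rfl⟩ ⟨b, rfl⟩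
    exact ⟨a * b, by apply Octonion.ext <;> simp [ι]⟩
  · intro x hx
    refine Submodule.span_le.2 ?_ (h x)
    rintro y (rfl | rfl)
    exacts [h1, hx]
  · rw [LinearMap.finrank_range_of_inj hι, Quaternion.finrank_eq_four]

theorem exists_isInvariantSubalgebra_finrank_ne_four :
    ∃ f : OctonionIsometry, ∀ T, f.IsInvariantSubalgebra T → Module.finrank ℝ T ≠ 4 :=
  ⟨⟨⟨Octonion.planeRotations, Octonion.norm_planeRotations⟩, Octonion.planeRotations_one⟩,
    fun _ hT => Octonion.finrank_ne_four_of_planeRotations hT.toIsSubalgebra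
      fun _ hx => hT.map_mem hx⟩

end OctonionIsometry

/-! ### Degree and identities of the cracovian algebra. -/

namespace Cracovian

variable {f : OctonionIsometry}

theorem hasDegree_eight (h : ∀ T, f.IsInvariantSubalgebra T → Module.finrank ℝ T ≠ 4) :
    HasDegree ℝ (Cracovian (OctonionIsotope f)) 8 := by
  refine ⟨fun x => ?_, fun m hm => ?_⟩
  · rw [← finrank_toOctonion]
    exact (Submodule.finrank_le _).trans Octonion.finrank_eq.le
  · by_contra! hm8
    obtain ⟨T, hT, hT4⟩ := f.exists_isInvariantSubalgebra_finrank_eq_four (fun x => by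
      -- Real multiples of `1` are set apart because for them `1` and `x` span only a line.
      by_cases hx : x ∈ Submodule.span ℝ {(1 : Octonion)}
      · obtain ⟨a, rfl⟩ := Submodule.mem_span_singleton.1 hx
        rw [map_smul, f.2]
        exact Submodule.smul_mem _ _ (Submodule.subset_span (by simp))
      have hxm : x ∈ toOctonion (NonUnitalAlgebra.adjoin ℝ
          ({x} : Set (Cracovian (OctonionIsotope f)))) :=
        NonUnitalAlgebra.self_mem_adjoin_singleton ℝ (A := Cracovian (OctonionIsotope f)) x
      have hle := hm x
      rw [← finrank_toOctonion] at hle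
      generalize hS : toOctonion (NonUnitalAlgebra.adjoin ℝ
          ({x} : Set (Cracovian (OctonionIsotope f)))) = S at hxm hle
      have hx0 : x ≠ 0 := by
        rintro rfl
        exact hx (Submodule.zero_mem _)
      have hSinv : f.IsInvariantSubalgebra S := by
        rw [← hS]
        apply isInvariantSubalgebra_toOctonion
        rw [hS]
        rintro rfl
        exact hx0 hxm
      -- A dimension of at least 3 would be at least 4, hence 4 or 8; the first is excluded by `h`,
      -- the second by the assumed bound below 8.
      have hS2 : Module.finrank ℝ S ≤ 2 := by
        by_contra! h3
        have h4 := hSinv.four_le_finrank h3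
        have h4' := h S hSinv
        rcases hSinv.eq_top_or_finrank_le with rfl | h5
        · rw [finrank_top, Octonion.finrank_eq] at hle
          omega
        · omega
      have hpair : Submodule.span ℝ {1, x} = S := by
        refine Submodule.eq_of_le_of_finrank_le ?_ (hS2.trans ?_)
        · rw [Submodule.span_le]
          rintro y (rfl | rfl)
          exacts [hSinv.one_mem, hxm]
        · by_contra! hlt
          have hle1 : Submodule.span ℝ {(1 : Octonion)} ≤ Submodule.span ℝ {1, x} :=
            Submodule.span_mono (by simp)
          have heq := Submodule.eq_of_le_of_finrank_le hle1 (by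
            rw [finrank_span_singleton Octonion.one_ne_zero']
            omega)
          rw [heq] at hx
          exact hx (Submodule.subset_span (by simp))
      rw [hpair]
      exact hSinv.map_mem hxm)
    exact h T hT hT4

theorem associator_eq (x y z : Octonion) :
    associator (show Cracovian (OctonionIsotope f) from x)
      (show Cracovian (OctonionIsotope f) from y) (show Cracovian (OctonionIsotope f) from z) =
      (star (f.1 (star (f.1 x) * f.1 y)) * f.1 z - star (f.1 x) * f.1 (star (f.1 y) * f.1 z) :
        Octonion) := by
  simp only [← f.map_star]
  rfl

theorem mul_self_eq (x : Octonion) :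
    ((show Cracovian (OctonionIsotope f) from x) * (show Cracovian (OctonionIsotope f) from x) :
      Cracovian (OctonionIsotope f)) = (⟪x, x⟫_ℝ • (1 : Octonion) : Octonion) := by
  rw [mul_eq, Octonion.star_mul_self, f.1.inner_map_map]

/-- Squares are real multiples of `1`, so only the associator of `1, y, 1` matters. Both of its
terms are the conjugate of `f (f y)`, because `f` commutes with conjugation. -/
theorem associator_sq_sq (x y : Cracovian (OctonionIsotope f)) :
    associator (x * x) y (x * x) = 0 := by
  refine (congrArg (fun z => associator z y z) (mul_self_eq (f := f) x)).trans
    ((associator_eq (f := f) _ y _).trans ?_)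
  simp only [map_smul, f.2, star_smul, star_trivial, smul_mul_assoc, mul_smul_comm,
    Octonion.star_one', Octonion.one_mul', Octonion.mul_one', f.map_star]
  exact sub_self _

theorem exists_associator_ne_zero :
    ∃ x : Cracovian (OctonionIsotope f), associator x (x * x) x ≠ 0 := by
  obtain ⟨u, μ, hu0, hu1, hfu⟩ := f.exists_imaginary_eigenvector
  have hμ : μ ≠ 0 := by
    rintro rfl
    exact f.map_ne_zero hu0 (by rw [hfu, zero_smul])
  have hx0 : (1 + u : Octonion) ≠ 0 := by
    intro h
    have := congrArg (fun z => ⟪u, z⟫_ℝ) h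
    simp only [inner_add_right, inner_zero_right, real_inner_comm 1 u, hu1, zero_add] at this
    exact hu0 (inner_self_eq_zero.1 this)
  refine ⟨(1 + u : Octonion), fun h => ?_⟩
  -- With `r = ‖1 + u‖²`, the associator is `r` times `(1 + μ²u)(1 + μu) - (1 - μu)(1 + μ²u)`, that
  -- is, `r(2μu + 2μ³u²)` with `u² = -‖u‖²`. Its `u`-component is nonzero.
  have h2 : (⟪(1 + u : Octonion), 1 + u⟫_ℝ * (2 * μ)) • u +
      (-2 * (μ ^ 3 * ⟪u, u⟫_ℝ) * ⟪(1 + u : Octonion), 1 + u⟫_ℝ) • (1 : Octonion) = 0 := by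
    refine Eq.trans ?_ (((associator_eq (f := f) (1 + u) _ (1 + u)).symm.trans
      (congrArg (fun z => associator (show Cracovian (OctonionIsotope f) from (1 + u : Octonion)) z
        (show Cracovian (OctonionIsotope f) from (1 + u : Octonion)))
        (mul_self_eq (f := f) (1 + u)).symm)).trans h)
    generalize ⟪(1 + u : Octonion), 1 + u⟫_ℝ = r
    simp only [map_add, map_smul, f.2, hfu, star_smul, star_trivial, star_add, star_neg,
      Octonion.star_eq_neg hu1, smul_mul_assoc, mul_smul_comm, mul_add, add_mul, map_neg, neg_mul,
      smul_add, smul_neg, neg_neg,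
      Octonion.star_one', Octonion.one_mul', Octonion.mul_one',
      Octonion.mul_self_of_inner_one_eq_zero hu1]
    module
  have hr := inner_self_ne_zero (𝕜 := ℝ).2 hx0
  generalize ⟪(1 + u : Octonion), 1 + u⟫_ℝ = r at h2 hr
  have h3 := congrArg (fun z => ⟪u, z⟫_ℝ) h2
  simp only [inner_add_right, inner_smul_right, inner_zero_right, real_inner_comm 1 u, hu1,
    mul_zero, add_zero] at h3
  exact mul_ne_zero (mul_ne_zero hr (mul_ne_zero two_ne_zero hμ)) (inner_self_ne_zero.2 hu0) h3

end Cracovian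

end

/-! ### Assembly through the correspondence of subalgebras. -/

theorem proposition4p6 :
    (∃ f : OctonionIsometry,
      ¬ ∃ S : NonUnitalSubalgebra ℝ (OctonionIsotope f), Module.finrank ℝ S = 4) ∧
    ∀ f : OctonionIsometry,
      (¬ ∃ S : NonUnitalSubalgebra ℝ (OctonionIsotope f), Module.finrank ℝ S = 4) →
      (∃ S : NonUnitalSubalgebra ℝ (Cracovian (OctonionIsotope f)), Module.finrank ℝ S = 2) ∧
      (¬ ∃ S : NonUnitalSubalgebra ℝ (Cracovian (OctonionIsotope f)), Module.finrank ℝ S = 4) ∧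
      HasDegree ℝ (Cracovian (OctonionIsotope f)) 8 ∧
      (∀ x y : Cracovian (OctonionIsotope f), associator (x * x) y (x * x) = 0) ∧
      ¬ ∀ x : Cracovian (OctonionIsotope f), associator x (x * x) x = 0 := by
  refine ⟨?_, fun f hf => ?_⟩
  · obtain ⟨f, hf⟩ := OctonionIsometry.exists_isInvariantSubalgebra_finrank_ne_four
    refine ⟨f, ?_⟩
    rintro ⟨S, hS⟩
    exact hf _ (OctonionIsotope.isInvariantSubalgebra_toOctonion S (by omega))
      ((OctonionIsotope.finrank_toOctonion S).trans hS)
  have h : ∀ T, f.IsInvariantSubalgebra T → Module.finrank ℝ T ≠ 4 := by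
    intro T hT hT4
    obtain ⟨S, hS⟩ := OctonionIsotope.exists_subalgebra_finrank_eq hT
    exact hf ⟨S, hS.trans hT4⟩
  refine ⟨?_, ?_, Cracovian.hasDegree_eight h, Cracovian.associator_sq_sq, ?_⟩
  · obtain ⟨T, hT, hT2⟩ := f.exists_isInvariantSubalgebra_finrank_eq_two
    obtain ⟨S, hS⟩ := Cracovian.exists_subalgebra_finrank_eq hT
    exact ⟨S, hS.trans hT2⟩
  · rintro ⟨S, hS⟩
    rw [← Cracovian.finrank_toOctonion] at hS
    refine h _ (Cracovian.isInvariantSubalgebra_toOctonion S ?_) hS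
    intro hb
    rw [hb, finrank_bot] at hS
    omega
  · obtain ⟨x, hx⟩ := Cracovian.exists_associator_ne_zero (f := f)
    exact fun h => hx (h x)
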